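/- All rings are commutative with identity, $k$ is a ring, $G$ is a finite group and $S$ is a $k$-algebra. A *unital partial action* $\alpha=(S_g,\alpha_g)_{g\in G}$ of $G$ on $S$ consists of ideals $S_g$ of $S$, each having an identity element $1_g$ (so $S_g=S1_g$), and $k$-algebra isomorphisms $\alpha_g:S_{g^{-1}}\to S_g$ such that $S_1=S$, $\alpha_1=\mathrm{id}_S$, $\alpha_g(S_{g^{-1}}\cap S_h)=S_g\cap S_{gh}$, and $\alpha_g(\alpha_h(x))=\alpha_{gh}(x)$ for $x\in S_{h^{-1}}\cap S_{(gh)^{-1}}$. Put $S^\alpha=\{s\in S:\alpha_g(s1_{g^{-1}})=s1_g\text{ for all }g\in G\}$. Say that $S$ is an *$\alpha$-partial Galois extension of $S^\alpha$* if there are $m\in\mathbb N$ and $x_i,y_i\in S$ $(1\le i\le m)$ with $\sum_{i=1}^m x_i\alpha_g(y_i1_{g^{-1}})=\delta_{1,g}$ for every $g\in G$. For a subgroup $H$ of $G$ let $\alpha_H=(S_h,\alpha_h)_{h\in H}$. A *globalization* of $\alpha$ is an action $\beta$ of $G$ by $k$-algebra automorphisms on a $k$-algebra $T$ which contains $S$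 as an ideal (with $1_S\neq 1_T$ allowed), such that $S_g=S\cap\beta_g(S)$, $\beta_g=\alpha_g$ on $S_{g^{-1}}$, and $T=\sum_{g\in G}\beta_g(S)$. **Theorem 3.1.** Let $\alpha$ be a unital partial action of the finite group $G$ on $S$ such that $S$ is an $\alpha$-partial Galois extension of $S^\alpha$, and let $H$ be a normal subgroup of $G$. Then $\alpha$ has a globalization, and there is a unital partial action $\alpha_{G/H}=(\tilde D_{gH},\alpha_{gH})_{gH\in G/H}$ of $G/H$ on $S^{\alpha_H}$ which is induced by $\alpha$ in the following sense. For every globalization $(T,\beta)$ of $\alpha$, every listing $H=\{h_1=1,h_2,\dots,h_m\}$ without repetition, and every $g\in G$, $$\tilde D_{gH}=S^{\alpha_H}\,\tilde 1_{gH},\qquad \tilde 1_{gH}=e_H\,\beta_g(e_H)\,1_S,\qquad \alpha_{gH}(x)=\beta_g(\psi_H(x))\,1_S\quad (x\in\tilde D_{g^{-1}H}),$$ where $\tilde 1_{gH}$ is the identity element of $\tilde D_{gH}$, $e_H=\psi_H(1_S)$ and, for $t\in T$, $$\psi_H(t)=\sum_{i=1}^m\beta_{h_i}(t)\,e_i,\qquad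 e_i=\Big(\prod_{j<i}\big(1_T-\beta_{h_j}(1_S)\big)\Big)\beta_{h_i}(1_S).$$ Moreover $(S^{\alpha_H})^{\alpha_{G/H}}=S^\alpha$, and $S^{\alpha_H}$ is an $\alpha_{G/H}$-partial Galois extension of $S^\alpha$. -/

import Mathlib

universe u v w w'

/-- A unital partial action of a group `G` on a commutative `k`-algebra `S`: ideals `S_g = dom g`,
each with an identity element `1_g = one g`, and `k`-algebra isomorphisms
`α_g = act g : S_{g⁻¹} → S_g` satisfying the axioms of a partial action. -/
structure UnitalPartialAction (k : Type w') (G : Type u) (S : Type v)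
    [CommRing k] [Group G] [CommRing S] [Algebra k S] where
  /-- the ideal `S_g` -/
  dom : G → Ideal S
  /-- the isomorphism `α_g : S_{g⁻¹} → S_g` -/
  act : ∀ g : G, dom g⁻¹ ≃ₗ[k] dom g
  act_mul : ∀ (g : G) (x y : dom g⁻¹),
    (act g ⟨(x : S) * y, (dom g⁻¹).mul_mem_left _ y.2⟩ : S) = act g x * act g y
  dom_one : dom 1 = ⊤
  act_one : ∀ x : dom (1 : G)⁻¹, (act 1 x : S) = x
  /-- `α_g (S_{g⁻¹} ∩ S_h) = S_g ∩ S_{gh}` -/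
  act_image : ∀ g h : G,
    (fun x : dom g⁻¹ => (act g x : S)) '' {x | (x : S) ∈ dom h} = (dom g : Set S) ∩ dom (g * h)
  /-- `α_g (α_h x) = α_{gh} x` for `x ∈ S_{h⁻¹} ∩ S_{(gh)⁻¹}` (including that the left-hand side
  makes sense) -/
  act_act : ∀ (g h : G) (x : S) (hx : x ∈ dom h⁻¹) (hx' : x ∈ dom (g * h)⁻¹),
    ∃ hy : (act h ⟨x, hx⟩ : S) ∈ dom g⁻¹,
      (act g ⟨act h ⟨x, hx⟩, hy⟩ : S) = act (g * h) ⟨x, hx'⟩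
  /-- the identity element `1_g` of the ideal `S_g` -/
  one : G → S
  one_mem : ∀ g, one g ∈ dom g
  mul_one_of_mem : ∀ g, ∀ x ∈ dom g, x * one g = x

namespace UnitalPartialAction

variable {k : Type w'} {G : Type u} {S : Type v} [CommRing k] [Group G] [CommRing S] [Algebra k S]

/-- The everywhere defined map `s ↦ α_g (s 1_{g⁻¹})` of `S`. -/
def app (α : UnitalPartialAction k G S) (g : G) (s : S) : S :=
  α.act g ⟨s * α.one g⁻¹, (α.dom g⁻¹).mul_mem_left s (α.one_mem g⁻¹)⟩

theorem app_add (α : UnitalPartialAction k G S) (g : G) (s t : S) :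
    α.app g (s + t) = α.app g s + α.app g t := by
  unfold app
  rw [← Submodule.coe_add, ← map_add]
  congr 3
  exact add_mul s t _

theorem app_mul (α : UnitalPartialAction k G S) (g : G) (s t : S) :
    α.app g (s * t) = α.app g s * α.app g t := by
  unfold app
  rw [← α.act_mul]
  congr 3
  have h := α.mul_one_of_mem g⁻¹ _ (α.one_mem g⁻¹)
  calc s * t * α.one g⁻¹ = s * t * (α.one g⁻¹ * α.one g⁻¹) := by rw [h]
    _ = _ := by ring

theorem app_smul (α : UnitalPartialAction k G S) (g : G) (r : k) (s : S) :
    α.app g (r • s) = r • α.app g s := by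
  unfold app
  rw [← Submodule.coe_smul_of_tower, ← map_smul]
  congr 3
  exact smul_mul_assoc r s _

theorem app_one (α : UnitalPartialAction k G S) (g : G) : α.app g 1 = α.one g := by
  obtain ⟨x, hx⟩ := (α.act g).surjective ⟨α.one g, α.one_mem g⟩
  have h1 : α.app g 1 * α.one g = α.app g 1 := α.mul_one_of_mem g _ (Subtype.property _)
  have h2 : α.app g x = α.one g := by
    unfold app
    have : (⟨(x : S) * α.one g⁻¹, (α.dom g⁻¹).mul_mem_left _ (α.one_mem g⁻¹)⟩ : α.dom g⁻¹) = x :=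
      Subtype.ext (α.mul_one_of_mem g⁻¹ x x.2)
    rw [this, hx]
  rw [← h1]
  nth_rewrite 1 [← h2]
  rw [← app_mul, one_mul, h2]

/-- The subalgebra of invariants `S^α = {s ∈ S : α_g (s 1_{g⁻¹}) = s 1_g for all g ∈ G}`. -/
def invariants (α : UnitalPartialAction k G S) : Subalgebra k S where
  carrier := {s | ∀ g : G, α.app g s = s * α.one g}
  mul_mem' := by
    intro s t hs ht g
    have h := α.mul_one_of_mem g _ (α.one_mem g)
    rw [app_mul, hs g, ht g]
    calc s * α.one g * (t * α.one g) = s * t * (α.one g * α.one g) := by ring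
      _ = _ := by rw [h]
  add_mem' := by
    intro s t hs ht g
    rw [app_add, hs g, ht g, add_mul]
  algebraMap_mem' := by
    intro r g
    rw [Algebra.algebraMap_eq_smul_one, app_smul, app_one, smul_mul_assoc, one_mul]

/-- The restriction `α_H = (S_h, α_h)_{h ∈ H}` of a partial action to a subgroup `H`. -/
def restrict (α : UnitalPartialAction k G S) (H : Subgroup G) : UnitalPartialAction k H S where
  dom h := α.dom h
  act h := α.act h
  act_mul h := α.act_mul h
  dom_one := α.dom_one
  act_one := α.act_one
  act_image g h := α.act_image g h
  act_act g h := α.act_act g h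
  one h := α.one h
  one_mem h := α.one_mem h
  mul_one_of_mem h := α.mul_one_of_mem h

/-- `S` is an `α`-partial Galois extension of `S^α`: there are partial Galois coordinates
`x_i, y_i ∈ S`, that is, `∑ x_i α_g (y_i 1_{g⁻¹}) = δ_{1,g}` for all `g ∈ G`. -/
def IsPartialGalois (α : UnitalPartialAction k G S) : Prop :=
  ∃ (m : ℕ) (x y : Fin m → S), ∀ g : G,
    (g = 1 → ∑ i, x i * α.app g (y i) = 1) ∧ (g ≠ 1 → ∑ i, x i * α.app g (y i) = 0)

/-- A globalization of `α`: a global action `β` of `G` on a `k`-algebra `T` that contains `S`,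
through `ι`, as an ideal, with `S_g = S ∩ β_g(S)`, `β_g = α_g` on `S_{g⁻¹}`, and
`T = ∑_g β_g(S)`. The map `ι` is not required to send `1_S` to `1_T`. -/
structure Globalization (α : UnitalPartialAction k G S) (T : Type w) [CommRing T]
    [Algebra k T] where
  β : G →* (T ≃ₐ[k] T)
  ι : S →ₙₐ[k] T
  ι_injective : Function.Injective ι
  mul_mem_range : ∀ (t : T) (s : S), t * ι s ∈ Set.range ι
  image_dom : ∀ g : G, ι '' (α.dom g : Set S) = Set.range ι ∩ (β g '' Set.range ι)
  β_ι : ∀ (g : G) (x : α.dom g⁻¹), β g (ι x) = ι (α.act g x)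
  closure_eq_top : AddSubgroup.closure (⋃ g : G, β g '' Set.range ι) = ⊤

namespace Globalization

variable {α : UnitalPartialAction k G S} {T : Type w} [CommRing T] [Algebra k T]

/-- For a list `h_0, h_1, …` of the elements of a subgroup, the idempotent
`e_i = (1_T - β_{h_0}(1_S)) ⋯ (1_T - β_{h_{i-1}}(1_S)) β_{h_i}(1_S)` of `T`. -/
def idem (E : Globalization α T) {n : ℕ} (h : Fin n → G) (i : Fin n) : T :=
  (∏ j ∈ Finset.Iio i, (1 - E.β (h j) (E.ι 1))) * E.β (h i) (E.ι 1)

/-- The map `ψ_H(t) = ∑_i β_{h_i}(t) e_i` of `T`. -/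
def psi (E : Globalization α T) {n : ℕ} (h : Fin n → G) (t : T) : T :=
  ∑ i, E.β (h i) t * E.idem h i

/-- `γ` is the partial action `α_{G/H}` of `G/H` on `S^{α_H}` that the globalization `(T, β)`
defines. With `e_H = ψ_H(1_S)` and `e_{gH} = e_H β_g(e_H)`, its ideals are those generated by the
idempotents `e_{gH} 1_S`, and its isomorphisms are `x ↦ β_g(ψ_H(x)) 1_S`. Here
`H = {h_0 = 1, h_1, …, h_n}` is listed in an arbitrary order. -/
def Induces (E : Globalization α T) (H : Subgroup G) [H.Normal]
    (γ : UnitalPartialAction k (G ⧸ H) (α.restrict H).invariants) : Prop :=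
  ∀ (n : ℕ) (h : Fin (n + 1) ≃ H), h 0 = 1 →
    let ψ : T → T := E.psi fun i => (h i : G)
    let e : T := ψ (E.ι 1)
    ∀ g : G,
      E.ι (γ.one (g : G ⧸ H) : S) = e * E.β g e * E.ι 1 ∧
      (γ.dom (g : G ⧸ H) : Set (α.restrict H).invariants) =
        {x : (α.restrict H).invariants | ∃ y : (α.restrict H).invariants,
          E.ι (x : S) = E.ι (y : S) * (e * E.β g e * E.ι 1)} ∧
      ∀ x : γ.dom (g : G ⧸ H)⁻¹,
        E.ι ((γ.act (g : G ⧸ H) x : (α.restrict H).invariants) : S) =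
          E.β g (ψ (E.ι ((x : (α.restrict H).invariants) : S))) * E.ι 1

end Globalization

end UnitalPartialAction

/-! Everything takes place in a globalization `T`. Since `H` is normal, `G/H` acts on `T^H`, and any
global action restricts to a unital partial action on an ideal with identity. So it suffices that
`ψ_H` embeds `S^{α_H}` as an ideal of `T^H`.

The key is a gluing principle. For `x` in `S^{α_H}` the elements `β_h(x)`, `h ∈ H`, agree on
overlaps, and `ψ_H(x)` is the unique `t` with `t β_h(1_S) = β_h(x)` for all `h ∈ H` and `t ∏ (1 -
β_h(1_S)) = 0` (`psi_mul_β_one`, `eq_of_forall_mul_eq`). Uniqueness gives multiplicativity,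
`H`-invariance and independence of the listing; multiplication by `1_S` inverts `ψ_H`. Cut down to
`S`, the defining formulas involve only `α` (`retract_β_psi`), so every globalization induces the
same partial action.

For the Galois property, `ψ_H` turns the partial trace of `H` into the orbit sum `∑ β_h(s)`
(`embedding_trace`), and Nakayama's lemma gives `c` of trace one. If `x_i, y_i` are Galois
coordinates for `α`, then `tr_H(c x_i), tr_H(y_i)` are coordinates for `G/H`. -/

/-! ### Ideals with identity as retracts. -/

/-- Over a commutative ring, an injective non-unital algebra homomorphism whose range is an ideal
splits: `a ↦ a * Ψ 1` retracts the big algebra onto the small one. -/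
noncomputable def NonUnitalAlgHom.retraction {k : Type*} {R : Type*} {A : Type*} [CommRing k]
    [CommRing R] [Algebra k R] [CommRing A] [Algebra k A] (Ψ : R →ₙₐ[k] A)
    (hinj : Function.Injective Ψ) (hideal : ∀ (a : A) (r : R), a * Ψ r ∈ Set.range Ψ) :
    A →ₐ[k] R :=
  have key : ∀ a, Ψ (hideal a 1).choose = a * Ψ 1 := fun a => (hideal a 1).choose_spec
  have idem : Ψ 1 * Ψ 1 = Ψ 1 := by rw [← map_mul, one_mul]
  AlgHom.ofLinearMap
    { toFun := fun a => (hideal a 1).choose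
      map_add' := fun a b => hinj (by rw [map_add, key, key, key, add_mul])
      map_smul' := fun c a => hinj (by
        rw [RingHom.id_apply, map_smul, key, key, smul_mul_assoc]) }
    (hinj (by
      change Ψ (hideal 1 1).choose = _
      rw [key, one_mul]))
    (fun a b => hinj (by
      change Ψ (hideal (a * b) 1).choose = Ψ ((hideal a 1).choose * (hideal b 1).choose)
      rw [map_mul, key, key, key]
      linear_combination -a * b * idem))

theorem NonUnitalAlgHom.apply_retraction {k : Type*} {R : Type*} {A : Type*} [CommRing k]
    [CommRing R] [Algebra k R] [CommRing A] [Algebra k A] (Ψ : R →ₙₐ[k] A)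
    (hinj : Function.Injective Ψ) (hideal : ∀ (a : A) (r : R), a * Ψ r ∈ Set.range Ψ) (a : A) :
    Ψ (Ψ.retraction hinj hideal a) = a * Ψ 1 :=
  (hideal a 1).choose_spec

theorem NonUnitalAlgHom.retraction_apply {k : Type*} {R : Type*} {A : Type*} [CommRing k]
    [CommRing R] [Algebra k R] [CommRing A] [Algebra k A] (Ψ : R →ₙₐ[k] A)
    (hinj : Function.Injective Ψ) (hideal : ∀ (a : A) (r : R), a * Ψ r ∈ Set.range Ψ) (r : R) :
    Ψ.retraction hinj hideal (Ψ r) = r :=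
  hinj (by rw [apply_retraction, ← map_mul, mul_one])

/-- A monoid homomorphism from a group to algebra endomorphisms takes values in automorphisms. -/
def MonoidHom.toAlgEquiv {k G A : Type*} [CommRing k] [Group G] [CommRing A] [Algebra k A]
    (φ : G →* (A →ₐ[k] A)) : G →* (A ≃ₐ[k] A) :=
  (AlgEquiv.algHomUnitsEquiv k A).toMonoidHom.comp φ.toHomUnits

/-! ### Calculus of the maps `s ↦ α_g(s 1_{g⁻¹})`. -/

namespace UnitalPartialAction

section

variable {k : Type w'} {G : Type u} {S : Type v} [CommRing k] [Group G] [CommRing S] [Algebra k S]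
  (α : UnitalPartialAction k G S)

theorem one_mul_one (g : G) : α.one g * α.one g = α.one g :=
  α.mul_one_of_mem g _ (α.one_mem g)

theorem app_mul_one (g : G) (s : S) : α.app g s * α.one g = α.app g s :=
  α.mul_one_of_mem g _ (Subtype.property _)

theorem act_eq_app (g : G) (x : α.dom g⁻¹) : (α.act g x : S) = α.app g x := by
  unfold app
  congr 2
  exact Subtype.ext (α.mul_one_of_mem g⁻¹ x x.2).symm

theorem one_one : α.one 1 = 1 := by
  have h := α.mul_one_of_mem 1 1 (by rw [α.dom_one]; trivial)
  rwa [one_mul] at h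

theorem app_one_left (s : S) : α.app 1 s = s := by
  unfold app
  rw [α.act_one]
  simp only [inv_one, one_one, mul_one]

theorem app_mul_one_inv (g : G) (s : S) : α.app g (s * α.one g⁻¹) = α.app g s := by
  rw [app_mul, ← act_eq_app α g ⟨α.one g⁻¹, α.one_mem g⁻¹⟩]
  have : (α.act g ⟨α.one g⁻¹, α.one_mem g⁻¹⟩ : S) = α.one g := by
    rw [← α.app_one g]
    unfold app
    congr 2
    exact Subtype.ext (one_mul _).symm
  rw [this, app_mul_one]

theorem app_one_one_inv (g : G) : α.app g (α.one g⁻¹) = α.one g := by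
  rw [← one_mul (α.one g⁻¹), app_mul_one_inv, app_one]

/-- `α_g` carries `S_{g⁻¹} ∩ S_h` onto `S_g ∩ S_{gh}`, hence the identity of the first ideal to that
of the second. -/
theorem app_one_eq (g h : G) : α.app g (α.one h) = α.one g * α.one (g * h) := by
  have hsurj : α.one g * α.one (g * h) ∈ (α.dom g : Set S) ∩ α.dom (g * h) :=
    ⟨(α.dom g).mul_mem_right _ (α.one_mem g), (α.dom (g * h)).mul_mem_left _ (α.one_mem _)⟩
  rw [← α.act_image] at hsurj
  obtain ⟨x, hx, hxe⟩ := hsurj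
  have hx' : (x : S) * α.one h = x := α.mul_one_of_mem h _ hx
  replace hxe : α.app g x = α.one g * α.one (g * h) := by rw [← act_eq_app]; exact hxe
  have h1 : α.app g x * α.app g (α.one h) = α.app g x := by rw [← app_mul, hx']
  have hmem : α.app g (α.one h) ∈ (α.dom g : Set S) ∩ α.dom (g * h) := by
    rw [← α.act_image]
    refine ⟨⟨α.one h * α.one g⁻¹, (α.dom g⁻¹).mul_mem_left _ (α.one_mem _)⟩,
      (α.dom h).mul_mem_right _ (α.one_mem h), ?_⟩
    change (α.act g _ : S) = _
    rw [act_eq_app, app_mul_one_inv]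
  have h2 := α.mul_one_of_mem _ _ hmem.1
  have h3 := α.mul_one_of_mem _ _ hmem.2
  rw [hxe] at h1
  linear_combination h1 - h3 - α.one (g * h) * h2

theorem app_app (g h : G) (s : S) :
    α.app g (α.app h s) = α.app (g * h) s * α.one g := by
  -- Composition is an axiom only on `S_{h⁻¹} ∩ S_{(gh)⁻¹}`, so `s` is first cut down to that ideal.
  have h1 : α.app h (s * α.one (g * h)⁻¹) = α.app h s * α.one g⁻¹ := by
    rw [app_mul, app_one_eq]
    have : h * (g * h)⁻¹ = g⁻¹ := by group
    rw [this, ← mul_assoc, app_mul_one]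
  have hy : s * α.one (g * h)⁻¹ * α.one h⁻¹ ∈ α.dom h⁻¹ :=
    (α.dom h⁻¹).mul_mem_left _ (α.one_mem _)
  have hy' : s * α.one (g * h)⁻¹ * α.one h⁻¹ ∈ α.dom (g * h)⁻¹ := by
    rw [mul_right_comm]
    exact (α.dom (g * h)⁻¹).mul_mem_left _ (α.one_mem _)
  obtain ⟨hz, hzz⟩ := α.act_act g h _ hy hy'
  rw [act_eq_app, act_eq_app, act_eq_app, app_mul_one_inv, h1, app_mul_one_inv, app_mul,
    app_mul_one_inv, app_one_eq, mul_inv_cancel_right, ← mul_assoc, app_mul_one] at hzz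
  exact hzz

theorem mem_invariants {s : S} : s ∈ α.invariants ↔ ∀ g : G, α.app g s = s * α.one g := Iff.rfl

theorem mem_invariants_restrict {H : Subgroup G} {s : S} :
    s ∈ (α.restrict H).invariants ↔ ∀ g ∈ H, α.app g s = s * α.one g :=
  ⟨fun h g hg => h ⟨g, hg⟩, fun h g => h g g.2⟩

theorem app_sum (g : G) {ι : Type*} (s : Finset ι) (f : ι → S) :
    α.app g (∑ i ∈ s, f i) = ∑ i ∈ s, α.app g (f i) :=
  map_sum (AddMonoidHom.mk' (α.app g) (α.app_add g)) f s

/-! ### The standard globalization. -/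

/-- The functions `f : G → S` such that `α_g (f(h) 1_{g⁻¹}) = f(h g⁻¹) 1_g`. They are the underlying
algebra of the standard globalization of `α`. -/
def compatibleFunctions : Subalgebra k (G → S) where
  carrier := {f | ∀ g h : G, α.app g (f h) = f (h * g⁻¹) * α.one g}
  mul_mem' := by
    intro a b ha hb g h
    rw [Pi.mul_apply, app_mul, ha, hb, Pi.mul_apply]
    linear_combination a (h * g⁻¹) * b (h * g⁻¹) * α.one_mul_one g
  add_mem' := by
    intro a b ha hb g h
    rw [Pi.add_apply, app_add, ha, hb, Pi.add_apply, add_mul]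
  algebraMap_mem' := by
    intro r g h
    simp only [Pi.algebraMap_apply]
    rw [Algebra.algebraMap_eq_smul_one, app_smul, app_one, smul_mul_assoc, one_mul]

/-- The action of `G` on `compatibleFunctions` by translation. -/
def translation : G →* (α.compatibleFunctions ≃ₐ[k] α.compatibleFunctions) :=
  MonoidHom.toAlgEquiv
    { toFun := fun g => AlgHom.ofLinearMap
        { toFun := fun f => ⟨fun h => f.1 (g⁻¹ * h), fun a h => by
            rw [f.2, mul_assoc]⟩
          map_add' := fun _ _ => rfl
          map_smul' := fun _ _ => rfl } rfl (fun _ _ => rfl)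
      map_one' := by
        ext f h
        change f.1 (1⁻¹ * h) = f.1 h
        rw [inv_one, one_mul]
      map_mul' := by
        intro a b
        ext f h
        change f.1 ((a * b)⁻¹ * h) = f.1 (b⁻¹ * (a⁻¹ * h))
        rw [mul_inv_rev, mul_assoc] }

theorem translation_apply (g h : G) (f : α.compatibleFunctions) :
    (α.translation g f).1 h = f.1 (g⁻¹ * h) := rfl

/-- The embedding `s ↦ (g ↦ α_{g⁻¹} (s 1_g))` into the standard globalization. -/
def orbitMap : S →ₙₐ[k] α.compatibleFunctions where
  toFun s := ⟨fun g => α.app g⁻¹ s, fun g h => by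
    change α.app g (α.app h⁻¹ s) = α.app (h * g⁻¹)⁻¹ s * α.one g
    rw [app_app, mul_inv_rev, inv_inv]⟩
  map_smul' r s := by ext g; exact α.app_smul _ r s
  map_zero' := by
    ext g
    have := α.app_smul g⁻¹ 0 (0 : S)
    rw [zero_smul, zero_smul] at this
    exact this
  map_add' s t := by ext g; exact α.app_add _ s t
  map_mul' s t := by ext g; exact α.app_mul _ s t

theorem orbitMap_apply (s : S) (g : G) : (α.orbitMap s).1 g = α.app g⁻¹ s := rfl

/-- Compatibility at the base point `1` gives `α_{g⁻¹}(f(1) 1_g) = f(g) 1_{g⁻¹}`. This makes the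
copy of `S` an ideal. -/
theorem mul_orbitMap (f : α.compatibleFunctions) (s : S) :
    f * α.orbitMap s = α.orbitMap (f.1 1 * s) := by
  ext g
  change f.1 g * α.app g⁻¹ s = α.app g⁻¹ (f.1 1 * s)
  rw [app_mul, f.2, one_mul, inv_inv, mul_assoc, mul_comm (α.one _), app_mul_one]

/-- The standard globalization of a unital partial action of a finite group. -/
def standardGlobalization [Finite G] : Globalization α α.compatibleFunctions where
  β := α.translation
  ι := α.orbitMap
  ι_injective := by
    intro s t hst
    have := congrArg (fun f => f.1 1) hst
    simpa only [orbitMap_apply, inv_one, app_one_left] using this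
  mul_mem_range := fun f s => ⟨_, (α.mul_orbitMap f s).symm⟩
  image_dom := by
    intro g
    ext f
    constructor
    · rintro ⟨s, hs, rfl⟩
      refine ⟨⟨s, rfl⟩, _, ⟨α.app g⁻¹ s, rfl⟩, ?_⟩
      ext h
      rw [translation_apply, orbitMap_apply, orbitMap_apply, app_app]
      rw [mul_inv_rev, inv_inv, mul_inv_cancel_right]
      have h1 : α.app h⁻¹ s = α.app h⁻¹ (s * α.one g) := by rw [α.mul_one_of_mem g s hs]
      rw [h1, app_mul, app_one_eq, ← mul_assoc, app_mul_one, mul_assoc, α.one_mul_one]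
    · rintro ⟨⟨s, rfl⟩, _, ⟨t, rfl⟩, hst⟩
      refine ⟨s, ?_, rfl⟩
      have := congrArg (fun f => f.1 1) hst
      simp only [translation_apply, orbitMap_apply, mul_one, inv_inv, inv_one,
        app_one_left] at this
      exact this ▸ Subtype.property _
  β_ι := by
    intro g x
    ext h
    rw [translation_apply, orbitMap_apply, orbitMap_apply, act_eq_app, app_app, mul_inv_rev,
      inv_inv]
    have h1 : α.app (h⁻¹ * g) x = α.app (h⁻¹ * g) (x * α.one g⁻¹) := by
      rw [α.mul_one_of_mem _ _ x.2]
    rw [h1, app_mul, app_one_eq, mul_inv_cancel_right, mul_assoc, mul_assoc, α.one_mul_one]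
  closure_eq_top := by
    classical
    have := Fintype.ofFinite G
    set C := AddSubgroup.closure (⋃ g : G, α.translation g '' Set.range α.orbitMap)
    have hmem : ∀ (g : G) (f : α.compatibleFunctions),
        f * α.translation g (α.orbitMap 1) ∈ C := by
      intro g f
      refine AddSubgroup.subset_closure (Set.mem_iUnion.2
        ⟨g, _, ⟨_, (α.mul_orbitMap (α.translation g⁻¹ f) 1).symm⟩, ?_⟩)
      rw [map_mul, ← AlgEquiv.mul_apply, ← map_mul, mul_inv_cancel, map_one, AlgEquiv.one_apply]
    -- `1 - ∏ (1 - u_g)` lies in the ideal generated by the idempotents `u_g = β_g(1_S)`; over all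
    -- of `G` it equals `1`.
    have hC : ∀ (s : Finset G) (f : α.compatibleFunctions),
        f * (1 - ∏ g ∈ s, (1 - α.translation g (α.orbitMap 1))) ∈ C := by
      intro s
      induction s using Finset.induction_on with
      | empty => intro f; rw [Finset.prod_empty, sub_self, mul_zero]; exact C.zero_mem
      | insert a s ha ih =>
        intro f
        rw [Finset.prod_insert ha]
        have := C.add_mem (ih f)
          (hmem a (f * ∏ g ∈ s, (1 - α.translation g (α.orbitMap 1))))
        convert this using 1
        ring
    -- At the point `h` the factor indexed by `h` vanishes.
    have hprod : ∏ g : G, (1 - α.translation g (α.orbitMap 1)) = 0 := by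
      ext h
      have h0 : (1 - α.translation h (α.orbitMap 1)).1 h = 0 := by
        change 1 - (α.translation h (α.orbitMap 1)).1 h = 0
        rw [translation_apply, inv_mul_cancel, orbitMap_apply, inv_one, app_one_left, sub_self]
      rw [← Finset.mul_prod_erase _ _ (Finset.mem_univ h)]
      change (1 - α.translation h (α.orbitMap 1)).1 h * _ = 0
      rw [h0, zero_mul]
    refine eq_top_iff.2 fun f _ => ?_
    have := hC Finset.univ f
    rwa [hprod, sub_zero, mul_one] at this

end

end UnitalPartialAction

/-! ### Restricting a global action to an ideal with identity. -/

namespace UnitalPartialAction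

section

variable {k : Type*} {Q : Type*} {R : Type*} {A : Type*} [CommRing k] [Group Q]
  [CommRing R] [Algebra k R] [CommRing A] [Algebra k A]
  (φ : Q →* (A ≃ₐ[k] A)) (Ψ : R →ₙₐ[k] A) (hinj : Function.Injective Ψ)
  (hideal : ∀ (a : A) (r : R), a * Ψ r ∈ Set.range Ψ)

theorem action_apply_apply (g h : Q) (a : A) : φ g (φ h a) = φ (g * h) a := by
  rw [map_mul, AlgEquiv.mul_apply]

theorem action_inv_apply_apply (g : Q) (a : A) : φ g⁻¹ (φ g a) = a := by
  rw [action_apply_apply, inv_mul_cancel, map_one, AlgEquiv.one_apply]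

theorem action_apply_inv_apply (g : Q) (a : A) : φ g (φ g⁻¹ a) = a := by
  rw [action_apply_apply, mul_inv_cancel, map_one, AlgEquiv.one_apply]

theorem embedding_one_mul (r : R) : Ψ 1 * Ψ r = Ψ r := by rw [← map_mul, one_mul]

/-- The ideal of those `r` whose image lies in the translate by `g` of the range of `Ψ`. -/
def embeddingDom (g : Q) : Ideal R where
  carrier := {r | Ψ r * φ g (Ψ 1) = Ψ r}
  add_mem' := by
    intro a b ha hb
    change Ψ (a + b) * φ g (Ψ 1) = Ψ (a + b)
    rw [map_add, add_mul, ha, hb]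
  zero_mem' := by
    change Ψ 0 * φ g (Ψ 1) = Ψ 0
    rw [map_zero, zero_mul]
  smul_mem' := by
    intro c x hx
    change Ψ (c * x) * φ g (Ψ 1) = Ψ (c * x)
    rw [map_mul, mul_assoc, hx]

theorem mem_embeddingDom {g : Q} {r : R} :
    r ∈ embeddingDom φ Ψ g ↔ Ψ r * φ g (Ψ 1) = Ψ r := Iff.rfl

/-- On the domain the retraction loses nothing: `Ψ r` absorbs `φ_{g⁻¹}(Ψ 1)`, so `φ_g(Ψ r)` absorbs
`Ψ 1`. -/
theorem apply_embeddingAct (g : Q) {r : R} (hr : r ∈ embeddingDom φ Ψ g⁻¹) :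
    Ψ (Ψ.retraction hinj hideal (φ g (Ψ r))) = φ g (Ψ r) := by
  rw [Ψ.apply_retraction]
  conv_rhs => rw [← (mem_embeddingDom φ Ψ).1 hr, map_mul, action_apply_inv_apply]

theorem embeddingAct_mem (g : Q) {r : R} (hr : r ∈ embeddingDom φ Ψ g⁻¹) :
    Ψ.retraction hinj hideal (φ g (Ψ r)) ∈ embeddingDom φ Ψ g := by
  rw [mem_embeddingDom, apply_embeddingAct φ Ψ hinj hideal g hr, ← map_mul, ← map_mul, mul_one]

/-- The partial action on an ideal (the range of `Ψ`), with an identity element, of an algebra on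
which a group acts globally. -/
noncomputable def ofEmbedding : UnitalPartialAction k Q R where
  dom := embeddingDom φ Ψ
  act g :=
    { toFun := fun r => ⟨Ψ.retraction hinj hideal (φ g (Ψ r)),
        embeddingAct_mem φ Ψ hinj hideal g r.2⟩
      map_add' := fun a b => Subtype.ext (by
        simp only [Submodule.coe_add, map_add])
      map_smul' := fun c a => Subtype.ext (by
        simp only [Submodule.coe_smul_of_tower, map_smul, RingHom.id_apply])
      invFun := fun r => ⟨Ψ.retraction hinj hideal (φ g⁻¹ (Ψ r)),
        embeddingAct_mem φ Ψ hinj hideal g⁻¹ ((inv_inv g).symm ▸ r.2)⟩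
      left_inv := fun r => Subtype.ext (hinj (by
        change Ψ (Ψ.retraction hinj hideal (φ g⁻¹ (Ψ (Ψ.retraction hinj hideal (φ g (Ψ r)))))) = _
        rw [apply_embeddingAct φ Ψ hinj hideal g r.2, action_inv_apply_apply, Ψ.retraction_apply]))
      right_inv := fun r => Subtype.ext (hinj (by
        change Ψ (Ψ.retraction hinj hideal (φ g (Ψ (Ψ.retraction hinj hideal (φ g⁻¹ (Ψ r)))))) = _
        rw [apply_embeddingAct φ Ψ hinj hideal g⁻¹ ((inv_inv g).symm ▸ r.2),
          action_apply_inv_apply, Ψ.retraction_apply])) }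
  act_mul g x y := by
    change Ψ.retraction hinj hideal (φ g (Ψ ((x : R) * y))) = _
    rw [map_mul, map_mul, map_mul]
    rfl
  dom_one := by
    refine eq_top_iff.2 fun r _ => ?_
    rw [mem_embeddingDom, map_one, AlgEquiv.one_apply, ← map_mul, mul_one]
  act_one x := by
    change Ψ.retraction hinj hideal (φ 1 (Ψ x)) = _
    rw [map_one, AlgEquiv.one_apply, Ψ.retraction_apply]
  act_image g h := by
    ext y
    constructor
    · rintro ⟨x, hx, rfl⟩
      refine ⟨embeddingAct_mem φ Ψ hinj hideal g x.2, ?_⟩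
      change Ψ (Ψ.retraction hinj hideal (φ g (Ψ x))) * φ (g * h) (Ψ 1) =
        Ψ (Ψ.retraction hinj hideal (φ g (Ψ x)))
      rw [apply_embeddingAct φ Ψ hinj hideal g x.2, ← action_apply_apply, ← map_mul,
        (mem_embeddingDom φ Ψ).1 hx]
    · rintro ⟨hg, hgh⟩
      have hg' : y ∈ embeddingDom φ Ψ g⁻¹⁻¹ := (inv_inv g).symm ▸ hg
      refine ⟨⟨_, embeddingAct_mem φ Ψ hinj hideal g⁻¹ hg'⟩, ?_, hinj ?_⟩
      · change Ψ (Ψ.retraction hinj hideal (φ g⁻¹ (Ψ y))) * φ h (Ψ 1) =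
          Ψ (Ψ.retraction hinj hideal (φ g⁻¹ (Ψ y)))
        rw [apply_embeddingAct φ Ψ hinj hideal g⁻¹ hg']
        conv_rhs => rw [← (mem_embeddingDom φ Ψ).1 hgh, map_mul, action_apply_apply, inv_mul_cancel_left]
      · change Ψ (Ψ.retraction hinj hideal (φ g (Ψ (Ψ.retraction hinj hideal (φ g⁻¹ (Ψ y)))))) = Ψ y
        rw [apply_embeddingAct φ Ψ hinj hideal g⁻¹ hg', action_apply_inv_apply, Ψ.retraction_apply]
  act_act g h x hx hx' := by
    have hy : Ψ.retraction hinj hideal (φ h (Ψ x)) ∈ embeddingDom φ Ψ g⁻¹ := by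
      rw [mem_embeddingDom, apply_embeddingAct φ Ψ hinj hideal h hx]
      conv_rhs => rw [← (mem_embeddingDom φ Ψ).1 hx', map_mul, action_apply_apply, mul_inv_rev,
        mul_inv_cancel_left]
    refine ⟨hy, ?_⟩
    change Ψ.retraction hinj hideal (φ g (Ψ (Ψ.retraction hinj hideal (φ h (Ψ x))))) =
      Ψ.retraction hinj hideal (φ (g * h) (Ψ x))
    rw [apply_embeddingAct φ Ψ hinj hideal h hx, action_apply_apply]
  one g := Ψ.retraction hinj hideal (φ g (Ψ 1))
  one_mem g := by
    rw [mem_embeddingDom, Ψ.apply_retraction, mul_right_comm, ← map_mul, ← map_mul, mul_one]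
  mul_one_of_mem g x hx := hinj (by
    rw [map_mul, Ψ.apply_retraction, ← mul_assoc, (mem_embeddingDom φ Ψ).1 hx, ← map_mul, mul_one])

theorem ofEmbedding_one (g : Q) :
    Ψ ((ofEmbedding φ Ψ hinj hideal).one g) = φ g (Ψ 1) * Ψ 1 :=
  Ψ.apply_retraction hinj hideal _

theorem ofEmbedding_act (g : Q) (x : (ofEmbedding φ Ψ hinj hideal).dom g⁻¹) :
    Ψ ((ofEmbedding φ Ψ hinj hideal).act g x) = φ g (Ψ x) * Ψ 1 :=
  Ψ.apply_retraction hinj hideal _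

theorem ofEmbedding_app (g : Q) (r : R) :
    Ψ ((ofEmbedding φ Ψ hinj hideal).app g r) = φ g (Ψ r) * Ψ 1 := by
  unfold app
  rw [ofEmbedding_act, map_mul, map_mul, ofEmbedding_one, map_mul, action_apply_inv_apply]
  have h1 : Ψ 1 * Ψ 1 = Ψ 1 := embedding_one_mul Ψ 1
  have h2 : φ g (Ψ r) * φ g (Ψ 1) = φ g (Ψ r) := by rw [← map_mul, ← map_mul, mul_one]
  linear_combination φ g (Ψ r) * φ g (Ψ 1) * h1 + Ψ 1 * h2

theorem mem_invariants_ofEmbedding {r : R} :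
    r ∈ (ofEmbedding φ Ψ hinj hideal).invariants ↔
      ∀ g, φ g (Ψ r) * Ψ 1 = Ψ r * φ g (Ψ 1) := by
  refine forall_congr' fun g => ?_
  rw [← hinj.eq_iff, ofEmbedding_app, map_mul, ofEmbedding_one, mul_comm (φ g (Ψ 1)), ← mul_assoc,
    ← map_mul, mul_one]

end

end UnitalPartialAction

/-! ### The partial trace and elements of trace one. -/

namespace UnitalPartialAction

section

variable {k : Type w'} {G : Type u} {S : Type v} [CommRing k] [Group G] [CommRing S] [Algebra k S]
  (α : UnitalPartialAction k G S)

/-- The trace `s ↦ ∑_{h ∈ H} α_h (s 1_{h⁻¹})`. -/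
def trace (H : Subgroup G) [Fintype H] (s : S) : S := ∑ h : H, α.app h s

theorem trace_mem_invariants (H : Subgroup G) [Fintype H] (s : S) :
    α.trace H s ∈ (α.restrict H).invariants := by
  rw [mem_invariants_restrict]
  intro g hg
  unfold trace
  rw [app_sum, Finset.sum_mul]
  refine Fintype.sum_equiv (Equiv.mulLeft ⟨g, hg⟩) _ _ fun h => ?_
  rw [app_app]
  rfl

theorem trace_add (H : Subgroup G) [Fintype H] (s t : S) :
    α.trace H (s + t) = α.trace H s + α.trace H t := by
  unfold trace
  rw [← Finset.sum_add_distrib]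
  exact Finset.sum_congr rfl fun h _ => α.app_add _ s t

theorem trace_mul (H : Subgroup G) [Fintype H] {r : S} (hr : r ∈ (α.restrict H).invariants)
    (s : S) : α.trace H (r * s) = r * α.trace H s := by
  unfold trace
  rw [Finset.mul_sum]
  refine Finset.sum_congr rfl fun h _ => ?_
  rw [app_mul, α.mem_invariants_restrict.1 hr h h.2, mul_assoc, mul_comm (α.one _), app_mul_one]

/-- Dual basis formula: after exchanging the sums, the Galois condition leaves only the term `h =
1`. -/
theorem sum_mul_trace (H : Subgroup G) [Fintype H] {m : ℕ} {x y : Fin m → S}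
    (hxy : ∀ g : G, (g = 1 → ∑ i, x i * α.app g (y i) = 1) ∧
      (g ≠ 1 → ∑ i, x i * α.app g (y i) = 0)) (s : S) :
    ∑ i, x i * α.trace H (y i * s) = s := by
  classical
  calc ∑ i, x i * α.trace H (y i * s)
      = ∑ h : H, (∑ i, x i * α.app h (y i)) * α.app h s := by
        simp only [trace, Finset.mul_sum, Finset.sum_mul, app_mul, mul_assoc]
        exact Finset.sum_comm
    _ = (∑ i, x i * α.app (1 : H) (y i)) * α.app (1 : H) s := by
        refine Finset.sum_eq_single 1 (fun h _ hh => ?_) (fun h => (h (Finset.mem_univ _)).elim)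
        rw [(hxy h).2 (fun h' => hh (Subtype.ext h')), zero_mul]
    _ = s := by
        rw [(hxy (1 : H)).1 rfl, one_mul]
        exact α.app_one_left s

/-- A partial Galois extension has an element of trace one for every finite subgroup. -/
theorem IsPartialGalois.exists_trace_eq_one {α : UnitalPartialAction k G S}
    (hα : α.IsPartialGalois) (H : Subgroup G) [Fintype H] : ∃ c : S, α.trace H c = 1 := by
  classical
  obtain ⟨m, x, y, hxy⟩ := hα
  let R := (α.restrict H).invariants
  let tr : S →ₗ[R] R :=
    { toFun := fun s => ⟨α.trace H s, α.trace_mem_invariants H s⟩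
      map_add' := fun s t => Subtype.ext (α.trace_add H s t)
      map_smul' := fun r s => Subtype.ext (α.trace_mul H r.2 s) }
  let I : Ideal R := LinearMap.range tr
  have hS : ∀ s : S, s = ∑ i, tr (y i * s) • x i := fun s => by
    conv_lhs => rw [← α.sum_mul_trace H hxy s]
    exact Finset.sum_congr rfl fun i _ => mul_comm _ _
  have hfg : (⊤ : Submodule R S).FG := by
    refine ⟨Finset.univ.image x, eq_top_iff.2 fun s _ => ?_⟩
    rw [hS s]
    exact Submodule.sum_mem _ fun i _ => Submodule.smul_mem _ _ (Submodule.subset_span (by simp))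
  -- With `I = tr_H(S)`, the dual basis formula says `S = I S`. Nakayama gives `r ∈ 1 + I` killing
  -- `S`; then `r = r · 1 = 0`, so `1 ∈ I`.
  have hle : (⊤ : Submodule R S) ≤ I • ⊤ := fun s _ => by
    rw [hS s]
    exact Submodule.sum_mem _ fun i _ =>
      Submodule.smul_mem_smul (LinearMap.mem_range_self tr _) trivial
  obtain ⟨r, hr, hr0⟩ :=
    Submodule.exists_sub_one_mem_and_smul_eq_zero_of_fg_of_le_smul I ⊤ hfg hle
  have hr1 : r = 0 := Subtype.ext (by simpa [Algebra.smul_def] using hr0 1 trivial)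
  rw [hr1, zero_sub] at hr
  obtain ⟨c, hc⟩ := neg_mem_iff.1 hr
  exact ⟨c, congrArg Subtype.val hc⟩

end

/-! ### Comparing a globalization with `α`; independence of its choice. -/

namespace Globalization

section

variable {k : Type w'} {G : Type u} {S : Type v} [CommRing k] [Group G] [CommRing S] [Algebra k S]
  {α : UnitalPartialAction k G S} {T : Type w} [CommRing T] [Algebra k T] (E : Globalization α T)

theorem ι_one_mul (s : S) : E.ι 1 * E.ι s = E.ι s := by rw [← map_mul, one_mul]

theorem mul_ι_one (s : S) : E.ι s * E.ι 1 = E.ι s := by rw [← map_mul, mul_one]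

/-- The retraction `T → S` onto the ideal `S`. -/
noncomputable def retract : T →ₐ[k] S := E.ι.retraction E.ι_injective E.mul_mem_range

theorem ι_retract (t : T) : E.ι (E.retract t) = t * E.ι 1 := E.ι.apply_retraction _ _ t

/-- The left side lies in `S ∩ β_g(S) = S_g`, so it absorbs `1_g = β_g(1_{g⁻¹})`, and `β_g(s
1_{g⁻¹})` is given by `α_g`. -/
theorem β_ι_mul_one (g : G) (s : S) : E.β g (E.ι s) * E.ι 1 = E.ι (α.app g s) := by
  have h1 : E.β g (E.ι (α.one g⁻¹)) = E.ι (α.one g) := by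
    have := E.β_ι g ⟨α.one g⁻¹, α.one_mem g⁻¹⟩
    rwa [α.act_eq_app, α.app_one_one_inv] at this
  have h2 : E.β g (E.ι s) * E.ι (α.one g) = E.ι (α.app g s) := by
    have := E.β_ι g ⟨s * α.one g⁻¹, (α.dom g⁻¹).mul_mem_left s (α.one_mem g⁻¹)⟩
    rwa [map_mul, map_mul, h1] at this
  have h3 : E.β g (E.ι s) * E.ι 1 ∈ Set.range E.ι ∩ (E.β g '' Set.range E.ι) := by
    refine ⟨E.mul_mem_range _ 1, E.β g⁻¹ (E.ι 1) * E.ι s, E.mul_mem_range _ s, ?_⟩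
    rw [map_mul, action_apply_inv_apply, mul_comm]
  rw [← E.image_dom] at h3
  obtain ⟨u, hu, hue⟩ := h3
  rw [← hue, ← α.mul_one_of_mem g u hu, map_mul, hue, mul_assoc, ι_one_mul, h2]

theorem retract_β (g : G) (s : S) : E.retract (E.β g (E.ι s)) = α.app g s :=
  E.ι_injective (by rw [ι_retract, β_ι_mul_one])

/-- The right side does not mention `T`; this is why the induced partial action is the same for all
globalizations. -/
theorem retract_β_psi {n : ℕ} (h : Fin n → G) (g : G) (s : S) :
    E.retract (E.β g (E.psi h (E.ι s))) =
      ∑ i, α.app (g * h i) s * ((∏ j ∈ Finset.Iio i, (1 - α.one (g * h j))) * α.one (g * h i)) := by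
  simp only [psi, idem, map_sum, map_mul, map_prod, map_sub, map_one]
  simp only [← AlgEquiv.mul_apply, ← map_mul, retract_β, app_one]

/-- The conditions read off inside `S`. The harmless `E.β 1` gives `e_H` the shape to which
`retract_β_psi` applies. -/
theorem induces_iff (H : Subgroup G) [H.Normal]
    (γ : UnitalPartialAction k (G ⧸ H) (α.restrict H).invariants) :
    E.Induces H γ ↔ ∀ (n : ℕ) (h : Fin (n + 1) ≃ H), h 0 = 1 →
      let ψ : T → T := E.psi fun i => (h i : G)
      ∀ g : G,
      (γ.one (g : G ⧸ H) : S) = E.retract (E.β 1 (ψ (E.ι 1))) * E.retract (E.β g (ψ (E.ι 1))) ∧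
      (γ.dom (g : G ⧸ H) : Set (α.restrict H).invariants) =
        {x : (α.restrict H).invariants | ∃ y : (α.restrict H).invariants,
          (x : S) = y * (E.retract (E.β 1 (ψ (E.ι 1))) * E.retract (E.β g (ψ (E.ι 1))))} ∧
      ∀ x : γ.dom (g : G ⧸ H)⁻¹,
        ((γ.act (g : G ⧸ H) x : (α.restrict H).invariants) : S) =
          E.retract (E.β g (ψ (E.ι ((x : (α.restrict H).invariants) : S)))) := by
  unfold Induces
  refine forall_congr' fun n => forall_congr' fun h => imp_congr_right fun _ =>
    forall_congr' fun g => ?_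
  simp only [map_one, AlgEquiv.one_apply, ← map_mul, ← ι_retract, E.ι_injective.eq_iff]

theorem Induces.congr {T' : Type*} [CommRing T'] [Algebra k T'] {E : Globalization α T}
    {H : Subgroup G} [H.Normal] {γ : UnitalPartialAction k (G ⧸ H) (α.restrict H).invariants}
    (hE : E.Induces H γ) (E' : Globalization α T') : E'.Induces H γ := by
  rw [induces_iff] at hE ⊢
  simpa only [retract_β_psi] using hE

/-! ### The subalgebra `T^H` and gluing over `H`. -/

/-- The subalgebra `T^H`. -/
def fixed (H : Subgroup G) : Subalgebra k T where
  carrier := {t | ∀ h ∈ H, E.β h t = t}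
  mul_mem' ha hb h hh := by rw [map_mul, ha h hh, hb h hh]
  add_mem' ha hb h hh := by rw [map_add, ha h hh, hb h hh]
  algebraMap_mem' r h _ := AlgEquiv.commutes _ r

theorem β_mem_fixed {H : Subgroup G} [hH : H.Normal] (g : G) {t : T} (ht : t ∈ E.fixed H) :
    E.β g t ∈ E.fixed H := by
  intro h hh
  rw [action_apply_apply]
  have := ht (g⁻¹ * h * g) (by simpa using hH.conj_mem h hh g⁻¹)
  conv_rhs => rw [← this, action_apply_apply]
  group

/-- The action of `G / H` on `T^H`. -/
def quotientAction (H : Subgroup G) [H.Normal] : G ⧸ H →* (E.fixed H ≃ₐ[k] E.fixed H) :=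
  QuotientGroup.lift H
    (MonoidHom.toAlgEquiv
      { toFun := fun g => AlgHom.codRestrict ((E.β g).toAlgHom.comp (E.fixed H).val) (E.fixed H)
          fun t => E.β_mem_fixed g t.2
        map_one' := AlgHom.ext fun t => Subtype.ext (by
          change E.β 1 t = t
          rw [map_one, AlgEquiv.one_apply])
        map_mul' := fun a b => AlgHom.ext fun t => Subtype.ext
          (action_apply_apply E.β a b t).symm })
    fun g hg => AlgEquiv.ext fun t => Subtype.ext (t.2 g hg)

theorem sum_idem {n : ℕ} (h : Fin n → G) :
    ∑ i, E.idem h i = 1 - ∏ i, (1 - E.β (h i) (E.ι 1)) := by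
  rw [Finset.prod_one_sub_ordered, sub_sub_cancel]
  refine Finset.sum_congr rfl fun i _ => ?_
  rw [idem, mul_comm]
  congr 2
  ext j
  simp

theorem β_ι_mul_β_one (g : G) (s : S) : E.β g (E.ι s) * E.β g (E.ι 1) = E.β g (E.ι s) := by
  rw [← map_mul, mul_ι_one]

theorem β_ι_mul_β_ι (g h : G) (s t : S) :
    E.β g (E.ι s) * E.β h (E.ι t) = E.β h (E.ι (α.app (h⁻¹ * g) s * t)) := by
  rw [map_mul, ← β_ι_mul_one, mul_assoc, ι_one_mul, map_mul, action_apply_apply,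
    mul_inv_cancel_left]

/-- The gluing condition on overlaps: moved back by `h⁻¹`, it is the invariance of `x` under `h⁻¹g`.
-/
theorem β_ι_mul_β_one_comm {H : Subgroup G} {x : S} (hx : x ∈ (α.restrict H).invariants)
    {g h : G} (hg : g ∈ H) (hh : h ∈ H) :
    E.β g (E.ι x) * E.β h (E.ι 1) = E.β h (E.ι x) * E.β g (E.ι 1) := by
  rw [β_ι_mul_β_ι, mul_one, α.mem_invariants_restrict.1 hx _ (H.mul_mem (H.inv_mem hh) hg),
    mul_comm (E.β h _), β_ι_mul_β_ι, app_one, mul_comm]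

variable {H : Subgroup G} [Fintype H]

theorem prod_listing {n : ℕ} (h : Fin n ≃ H) :
    ∏ i, (1 - E.β (h i) (E.ι 1)) = ∏ g : H, (1 - E.β g (E.ι 1)) :=
  Fintype.prod_equiv h _ _ fun _ => rfl

/-- Uniqueness of gluing: `a - b` is killed by each `β_g(1_S)`, so multiplying by `∏ (1 - β_g(1_S))`
fixes it, yet also gives zero. -/
theorem eq_of_forall_mul_eq {a b : T} (ha : a * ∏ g : H, (1 - E.β g (E.ι 1)) = 0)
    (hb : b * ∏ g : H, (1 - E.β g (E.ι 1)) = 0)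
    (hab : ∀ g ∈ H, a * E.β g (E.ι 1) = b * E.β g (E.ι 1)) : a = b := by
  classical
  have key : ∀ s : Finset H, (a - b) * ∏ g ∈ s, (1 - E.β g (E.ι 1)) = a - b := by
    intro s
    induction s using Finset.induction_on with
    | empty => rw [Finset.prod_empty, mul_one]
    | insert g s hg ih =>
      rw [Finset.prod_insert hg]
      linear_combination (1 - E.β g (E.ι 1)) * ih - hab g g.2
  have := key Finset.univ
  rw [sub_mul, ha, hb, sub_zero] at this
  exact sub_eq_zero.1 this.symm

theorem β_one_mul_prod {g : G} (hg : g ∈ H) :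
    E.β g (E.ι 1) * ∏ g : H, (1 - E.β g (E.ι 1)) = 0 := by
  classical
  rw [← Finset.mul_prod_erase _ _ (Finset.mem_univ (⟨g, hg⟩ : H)), ← mul_assoc]
  have : E.β g (E.ι 1) * (1 - E.β g (E.ι 1)) = 0 := by
    rw [mul_sub, β_ι_mul_β_one, mul_one, sub_self]
  rw [this, zero_mul]

theorem psi_mul_prod {n : ℕ} (h : Fin n ≃ H) (t : T) :
    E.psi (fun i => (h i : G)) t * ∏ g : H, (1 - E.β g (E.ι 1)) = 0 := by
  rw [psi, Finset.sum_mul]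
  refine Finset.sum_eq_zero fun i _ => ?_
  rw [idem, mul_assoc, mul_assoc, E.β_one_mul_prod (h i).2, mul_zero, mul_zero]

/-- Existence of gluing: by the overlap condition `β_g(x)` can replace `β_{h_i}(x)` in each term,
and `∑ e_i` acts as the identity on `β_g(S)`. -/
theorem psi_mul_β_one {n : ℕ} (h : Fin n ≃ H) {x : S} (hx : x ∈ (α.restrict H).invariants)
    {g : G} (hg : g ∈ H) :
    E.psi (fun i => (h i : G)) (E.ι x) * E.β g (E.ι 1) = E.β g (E.ι x) := by
  have h1 : E.psi (fun i => (h i : G)) (E.ι x) * E.β g (E.ι 1) =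
      E.β g (E.ι x) * ∑ i, E.idem (fun i => (h i : G)) i := by
    rw [psi, Finset.sum_mul, Finset.mul_sum]
    refine Finset.sum_congr rfl fun i _ => ?_
    have h2 := E.β_ι_mul_β_one_comm hx (h i).2 hg
    have h3 := E.β_ι_mul_β_one (h i) 1
    rw [idem]
    linear_combination (∏ j ∈ Finset.Iio i, (1 - E.β (h j) (E.ι 1))) * E.β (h i) (E.ι 1) * h2 +
      (∏ j ∈ Finset.Iio i, (1 - E.β (h j) (E.ι 1))) * E.β g (E.ι x) * h3
  rw [h1, sum_idem, prod_listing, mul_sub, mul_one, ← β_ι_mul_β_one, mul_assoc (E.β g (E.ι x)),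
    E.β_one_mul_prod hg, mul_zero, sub_zero]

theorem β_prod {g : G} (hg : g ∈ H) :
    E.β g (∏ h : H, (1 - E.β h (E.ι 1))) = ∏ h : H, (1 - E.β h (E.ι 1)) := by
  rw [map_prod]
  refine Fintype.prod_equiv (Equiv.mulLeft ⟨g, hg⟩) _ _ fun h => ?_
  rw [map_sub, map_one, action_apply_apply]
  rfl

theorem psi_mem_fixed {n : ℕ} (h : Fin n ≃ H) {x : S} (hx : x ∈ (α.restrict H).invariants) :
    E.psi (fun i => (h i : G)) (E.ι x) ∈ E.fixed H := by
  intro g hg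
  refine E.eq_of_forall_mul_eq (H := H) ?_ (E.psi_mul_prod h _) fun a ha => ?_
  · rw [← E.β_prod hg, ← map_mul, psi_mul_prod, map_zero]
  · have : E.β a (E.ι 1) = E.β g (E.β (g⁻¹ * a) (E.ι 1)) := by
      rw [action_apply_apply, mul_inv_cancel_left]
    rw [E.psi_mul_β_one h hx ha, this, ← map_mul,
      E.psi_mul_β_one h hx (H.mul_mem (H.inv_mem hg) ha), action_apply_apply,
      mul_inv_cancel_left]

end

end Globalization

end UnitalPartialAction

/-! ### `S^{α_H}` as an ideal of `T^H`. -/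

namespace UnitalPartialAction

namespace Globalization

section

variable {k : Type w'} {G : Type u} {S : Type v} [CommRing k] [Group G] [CommRing S] [Algebra k S]
  {α : UnitalPartialAction k G S} {T : Type w} [CommRing T] [Algebra k T] (E : Globalization α T)
  (H : Subgroup G) [Fintype H]

/-- The embedding of `S^{α_H}` as an ideal of `T^H`, given by `ψ_H`. -/
noncomputable def embedding : (α.restrict H).invariants →ₙₐ[k] E.fixed H where
  toFun x := ⟨_, E.psi_mem_fixed (Fintype.equivFin H).symm x.2⟩
  map_smul' r x := Subtype.ext (by
    change E.psi _ (E.ι (r • (x : S))) = r • E.psi _ (E.ι x)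
    simp only [psi, map_smul, Finset.smul_sum, smul_mul_assoc])
  map_zero' := Subtype.ext (by
    change E.psi _ (E.ι 0) = 0
    simp only [psi, map_zero, zero_mul, Finset.sum_const_zero])
  map_add' x y := Subtype.ext (by
    change E.psi _ (E.ι ((x : S) + y)) = E.psi _ (E.ι x) + E.psi _ (E.ι y)
    simp only [psi, map_add, add_mul, Finset.sum_add_distrib])
  map_mul' x y := Subtype.ext (by
    change E.psi _ (E.ι ((x * y : (α.restrict H).invariants) : S)) =
      E.psi _ (E.ι x) * E.psi _ (E.ι y)
    refine E.eq_of_forall_mul_eq (E.psi_mul_prod _ _) ?_ fun g hg => ?_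
    · rw [mul_assoc, psi_mul_prod, mul_zero]
    · rw [E.psi_mul_β_one _ (x * y).2 hg, mul_assoc, E.psi_mul_β_one _ y.2 hg, Subalgebra.coe_mul,
        map_mul, map_mul, ← E.psi_mul_β_one (Fintype.equivFin H).symm x.2 hg, mul_assoc,
        mul_comm (E.β g (E.ι 1)), β_ι_mul_β_one])

variable {H}

theorem embedding_mul_prod (x : (α.restrict H).invariants) :
    (E.embedding H x : T) * ∏ g : H, (1 - E.β g (E.ι 1)) = 0 :=
  E.psi_mul_prod _ _

theorem embedding_mul_β_one (x : (α.restrict H).invariants) {g : G} (hg : g ∈ H) :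
    (E.embedding H x : T) * E.β g (E.ι 1) = E.β g (E.ι x) :=
  E.psi_mul_β_one _ x.2 hg

theorem embedding_mul_one (x : (α.restrict H).invariants) :
    (E.embedding H x : T) * E.ι 1 = E.ι x := by
  simpa only [map_one, AlgEquiv.one_apply] using E.embedding_mul_β_one x H.one_mem

theorem eq_embedding {x : (α.restrict H).invariants} {a : T}
    (ha : a * ∏ g : H, (1 - E.β g (E.ι 1)) = 0)
    (h : ∀ g ∈ H, a * E.β g (E.ι 1) = E.β g (E.ι x)) : a = E.embedding H x :=
  E.eq_of_forall_mul_eq ha (E.embedding_mul_prod x) fun g hg => by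
    rw [h g hg, E.embedding_mul_β_one x hg]

theorem eq_of_forall_mul_translate_eq (g : G) {a b : T}
    (ha : a * E.β g (∏ h : H, (1 - E.β h (E.ι 1))) = 0)
    (hb : b * E.β g (∏ h : H, (1 - E.β h (E.ι 1))) = 0)
    (hab : ∀ h ∈ H, a * E.β (g * h) (E.ι 1) = b * E.β (g * h) (E.ι 1)) : a = b := by
  have key : ∀ c d : T, E.β g⁻¹ c * d = E.β g⁻¹ (c * E.β g d) := fun c d => by
    rw [map_mul, action_inv_apply_apply]
  refine (E.β g⁻¹).injective (E.eq_of_forall_mul_eq (H := H) ?_ ?_ fun h hh => ?_)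
  · rw [key, ha, map_zero]
  · rw [key, hb, map_zero]
  · rw [key, key, action_apply_apply, hab h hh]

theorem psi_eq_embedding {n : ℕ} (h : Fin n ≃ H) (x : (α.restrict H).invariants) :
    E.psi (fun i => (h i : G)) (E.ι x) = E.embedding H x :=
  E.eq_embedding (E.psi_mul_prod h _) fun _ hg => E.psi_mul_β_one h x.2 hg

theorem embedding_injective : Function.Injective (E.embedding H) := fun x y hxy =>
  Subtype.ext (E.ι_injective (by rw [← embedding_mul_one, hxy, embedding_mul_one]))

/-- The preimage is `a x`, which lies in the ideal `S` and is `α_H`-invariant because `a` is fixed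
by `H`. -/
theorem mul_embedding_mem_range (a : E.fixed H) (x : (α.restrict H).invariants) :
    a * E.embedding H x ∈ Set.range (E.embedding H) := by
  have hy : E.ι (E.retract (a * E.ι x)) = a * E.ι x := by
    rw [ι_retract, mul_assoc, mul_ι_one]
  have hmem : E.retract (a * E.ι x) ∈ (α.restrict H).invariants := by
    rw [mem_invariants_restrict]
    intro g hg
    apply E.ι_injective
    have h1 := E.β_ι_mul_β_one_comm x.2 hg H.one_mem
    simp only [map_one, AlgEquiv.one_apply] at h1
    have h2 : E.ι (α.one g) = E.β g (E.ι 1) * E.ι 1 := by rw [β_ι_mul_one, app_one]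
    rw [← β_ι_mul_one, hy, map_mul E.ι, hy, map_mul (E.β g), a.2 g hg, h2, mul_assoc, h1]
    linear_combination -(a : T) * E.β g (E.ι 1) * E.mul_ι_one x
  refine ⟨⟨_, hmem⟩, Subtype.ext (E.eq_embedding ?_ fun g hg => ?_).symm⟩
  · rw [Subalgebra.coe_mul, mul_assoc, embedding_mul_prod, mul_zero]
  · rw [Subalgebra.coe_mul, mul_assoc, E.embedding_mul_β_one x hg, hy, map_mul, a.2 g hg]

/-- The orbit sum is fixed by `H`, and its product with `1_S` is the partial trace. -/
theorem embedding_trace (s : S) :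
    (E.embedding H ⟨α.trace H s, α.trace_mem_invariants H s⟩ : T) = ∑ g : H, E.β g (E.ι s) := by
  refine (E.eq_embedding ?_ fun a ha => ?_).symm
  · rw [Finset.sum_mul]
    refine Finset.sum_eq_zero fun g _ => ?_
    rw [← β_ι_mul_β_one, mul_assoc, E.β_one_mul_prod g.2, mul_zero]
  · have h1 : E.β a (∑ g : H, E.β g (E.ι s)) = ∑ g : H, E.β g (E.ι s) := by
      rw [map_sum]
      refine Fintype.sum_equiv (Equiv.mulLeft ⟨a, ha⟩) _ _ fun g => ?_
      rw [action_apply_apply]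
      rfl
    rw [← h1, ← map_mul, Finset.sum_mul]
    congr 1
    simp only [β_ι_mul_one, trace, map_sum]

/-! ### The partial action of `G/H`, its invariants and its Galois coordinates. -/

variable [H.Normal]

variable (H) in
/-- The partial action of `G / H` on `S^{α_H}` defined by a globalization. -/
noncomputable def quotientPartialAction :
    UnitalPartialAction k (G ⧸ H) (α.restrict H).invariants :=
  ofEmbedding (E.quotientAction H) (E.embedding H) E.embedding_injective E.mul_embedding_mem_range

theorem ι_quotientPartialAction_one (g : G) :
    E.ι ((E.quotientPartialAction H).one (g : G ⧸ H) : S) =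
      E.embedding H 1 * E.β g (E.embedding H 1) * E.ι 1 := by
  have := congrArg (fun a : E.fixed H => (a : T)) (ofEmbedding_one (E.quotientAction H)
    (E.embedding H) E.embedding_injective E.mul_embedding_mem_range (g : G ⧸ H))
  rw [← embedding_mul_one, mul_comm (E.embedding H 1 : T)]
  exact congrArg (· * E.ι 1) this

theorem quotientPartialAction_induces : E.Induces H (E.quotientPartialAction H) := by
  intro n h _ ψ e g
  have he : e = E.embedding H 1 := E.psi_eq_embedding h 1
  rw [he]
  refine ⟨E.ι_quotientPartialAction_one g, ?_, fun x => ?_⟩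
  · ext x
    rw [← ι_quotientPartialAction_one]
    simp only [← map_mul, E.ι_injective.eq_iff]
    constructor
    · intro hx
      exact ⟨x, (congrArg Subtype.val ((E.quotientPartialAction H).mul_one_of_mem _ x hx)).symm⟩
    · rintro ⟨y, hy⟩
      have hy' : x = y * (E.quotientPartialAction H).one (g : G ⧸ H) := Subtype.ext hy
      rw [hy']
      exact Ideal.mul_mem_left _ _ ((E.quotientPartialAction H).one_mem _)
  · have := congrArg (fun a : E.fixed H => (a : T)) (ofEmbedding_act (E.quotientAction H)
      (E.embedding H) E.embedding_injective E.mul_embedding_mem_range (g : G ⧸ H) x)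
    change _ = E.β g (E.psi (fun i => (h i : G)) _) * _
    rw [← embedding_mul_one, psi_eq_embedding]
    refine (congrArg (· * E.ι 1) this).trans ?_
    change E.β g (E.embedding H x) * (E.embedding H 1) * E.ι 1 = _
    rw [mul_assoc, embedding_mul_one]
    rfl

theorem embedding_quotientPartialAction_app (g : G) (x : (α.restrict H).invariants) :
    (E.embedding H ((E.quotientPartialAction H).app (g : G ⧸ H) x) : T) =
      E.β g (E.embedding H x) * E.embedding H 1 :=
  congrArg (fun a : E.fixed H => (a : T)) (ofEmbedding_app (E.quotientAction H)
    (E.embedding H) E.embedding_injective E.mul_embedding_mem_range (g : G ⧸ H) x)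

theorem mem_quotientPartialAction_invariants {x : (α.restrict H).invariants} :
    x ∈ (E.quotientPartialAction H).invariants ↔ (x : S) ∈ α.invariants := by
  have h0 : x ∈ (E.quotientPartialAction H).invariants ↔ ∀ g : G,
      E.β g (E.embedding H x) * E.embedding H 1 = E.embedding H x * E.β g (E.embedding H 1) := by
    refine (mem_invariants_ofEmbedding (E.quotientAction H) (E.embedding H)
      E.embedding_injective E.mul_embedding_mem_range).trans ?_
    rw [QuotientGroup.mk_surjective.forall]
    exact forall_congr' fun g => Subtype.ext_iff
  have hβ : ∀ (y : (α.restrict H).invariants) (g : G) {a : G}, a ∈ H →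
      E.β g (E.embedding H y) * E.β (g * a) (E.ι 1) = E.β (g * a) (E.ι y) := by
    intro y g a ha
    rw [← action_apply_apply, ← map_mul, E.embedding_mul_β_one y ha, action_apply_apply]
  rw [h0]
  constructor
  · intro hx g
    apply E.ι_injective
    have h1 := hβ x g H.one_mem
    have h2 := hβ 1 g H.one_mem
    rw [mul_one] at h1 h2
    have h3 := E.embedding_mul_one x
    have h4 := E.embedding_mul_one (1 : (α.restrict H).invariants)
    rw [Subalgebra.coe_one] at h2 h4
    have h5 : E.ι (α.one g) = E.β g (E.ι 1) * E.ι 1 := by rw [β_ι_mul_one, app_one]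
    rw [map_mul, ← β_ι_mul_one, ← h1, ← h3, h5]
    have h6 := E.mul_ι_one 1
    -- The invariance equation in `T^H` is multiplied by `1_S β_g(1_S)`.
    linear_combination E.β g (E.ι 1) * E.ι 1 * hx g -
      E.β g (E.embedding H x) * E.β g (E.ι 1) * h4 +
      E.embedding H x * E.ι 1 * h2 - E.embedding H x * E.β g (E.ι 1) * h6
  · intro hx g
    have hcomm : ∀ a b : G, E.β a (E.ι x) * E.β b (E.ι 1) = E.β b (E.ι x) * E.β a (E.ι 1) := by
      intro a b
      rw [β_ι_mul_β_ι, mul_one, α.mem_invariants.1 hx, mul_comm (E.β b _), β_ι_mul_β_ι, app_one,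
        mul_comm]
    have hprod : ∀ y : (α.restrict H).invariants,
        E.β g (E.embedding H y) * E.β g (∏ a : H, (1 - E.β a (E.ι 1))) = 0 := fun y => by
      rw [← map_mul, embedding_mul_prod, map_zero]
    -- The equation is tested on the pieces `β_a(1_S)` of `e_H`, then on the pieces `β_{gb}(1_S)` of
    -- `β_g(e_H)`, where it becomes `hcomm`.
    refine E.eq_of_forall_mul_eq (H := H) ?_ ?_ fun a ha => ?_
    · rw [mul_assoc, embedding_mul_prod, mul_zero]
    · rw [mul_right_comm, embedding_mul_prod, zero_mul]
    · rw [mul_assoc, E.embedding_mul_β_one 1 ha, mul_right_comm, E.embedding_mul_β_one x ha,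
        Subalgebra.coe_one]
      refine E.eq_of_forall_mul_translate_eq (H := H) g ?_ ?_ fun b hb => ?_
      · rw [mul_right_comm, hprod, zero_mul]
      · rw [mul_assoc, hprod, mul_zero]
      · have h1 := hβ 1 g hb
        rw [Subalgebra.coe_one] at h1
        rw [mul_right_comm, hβ x g hb, mul_assoc, h1, hcomm]

theorem quotientPartialAction_isPartialGalois (hα : α.IsPartialGalois) :
    (E.quotientPartialAction H).IsPartialGalois := by
  classical
  obtain ⟨c, hc⟩ := hα.exists_trace_eq_one H
  obtain ⟨m, x, y, hxy⟩ := hα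
  have hgal : ∀ g : G, ∑ i, E.ι (x i) * E.β g (E.ι (y i)) = if g = 1 then E.ι 1 else 0 := by
    intro g
    have h1 : ∀ i, E.ι (x i) * E.β g (E.ι (y i)) = E.ι (x i * α.app g (y i)) := fun i => by
      rw [map_mul, ← β_ι_mul_one, mul_comm (E.β g _), ← mul_assoc, mul_ι_one]
    simp only [h1, ← map_sum]
    split_ifs with h
    · rw [(hxy g).1 h]
    · rw [(hxy g).2 h, map_zero]
  have hc' : ∑ a : H, E.β a (E.ι c) = E.embedding H 1 := by
    rw [← embedding_trace]
    congr 2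
    exact Subtype.ext hc
  -- The factor `c` makes the diagonal terms below add up to `∑ β_a(c) = ψ_H(tr_H c) = e_H`.
  let X : Fin m → (α.restrict H).invariants := fun i => ⟨_, α.trace_mem_invariants H (c * x i)⟩
  let Y : Fin m → (α.restrict H).invariants := fun i => ⟨_, α.trace_mem_invariants H (y i)⟩
  have hsum : ∀ g : G,
      ∑ i, (E.embedding H (X i) : T) * E.β g (E.embedding H (Y i)) =
        ∑ a : H, ∑ b : H, if (a : G)⁻¹ * (g * b) = 1 then E.β a (E.ι c) else 0 := by
    intro g
    simp only [X, Y, embedding_trace, map_sum, Finset.sum_mul_sum]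
    rw [Finset.sum_comm]
    refine Finset.sum_congr rfl fun a _ => ?_
    rw [Finset.sum_comm]
    refine Finset.sum_congr rfl fun b _ => ?_
    have h1 : ∀ i, E.β a (E.ι (c * x i)) * E.β g (E.β b (E.ι (y i))) =
        E.β a (E.ι c * (E.ι (x i) * E.β ((a : G)⁻¹ * (g * b)) (E.ι (y i)))) := fun i => by
      rw [map_mul E.ι, ← mul_assoc, map_mul (E.β a) (_ * _), action_apply_apply,
        action_apply_apply, mul_inv_cancel_left]
    simp only [h1, ← map_sum, ← Finset.mul_sum, hgal]
    split_ifs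
    · rw [mul_ι_one]
    · rw [mul_zero, map_zero]
  have hemb : ∀ g : G, (E.embedding H (∑ i, X i * (E.quotientPartialAction H).app (g : G ⧸ H)
      (Y i)) : T) = (∑ i, (E.embedding H (X i) : T) * E.β g (E.embedding H (Y i))) *
        E.embedding H 1 := by
    intro g
    rw [map_sum, AddSubmonoidClass.coe_finsetSum, Finset.sum_mul]
    refine Finset.sum_congr rfl fun i _ => ?_
    rw [map_mul, Subalgebra.coe_mul, embedding_quotientPartialAction_app, mul_assoc]
  refine ⟨m, X, Y, fun q => ⟨?_, ?_⟩⟩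
  · rintro rfl
    refine E.embedding_injective (Subtype.ext ((hemb 1).trans ?_))
    have h1 : ∀ a b : H, (a : G)⁻¹ * (1 * b) = 1 ↔ b = a := fun a b => by
      rw [one_mul, inv_mul_eq_one, eq_comm, Subtype.ext_iff]
    simp only [hsum, h1, Finset.sum_ite_eq', Finset.mem_univ, if_true]
    rw [hc', ← Subalgebra.coe_mul, embedding_one_mul]
  · obtain ⟨g, rfl⟩ := QuotientGroup.mk_surjective q
    intro hg
    refine E.embedding_injective (Subtype.ext ((hemb g).trans ?_))
    rw [hsum, Finset.sum_eq_zero, zero_mul, map_zero, Subalgebra.coe_zero]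
    intro a _
    -- A surviving term would have `a = g b` with `a, b ∈ H`, forcing `g ∈ H`.
    refine Finset.sum_eq_zero fun b _ => if_neg fun hab => hg ?_
    rw [QuotientGroup.eq_one_iff]
    have : g = a * (b : G)⁻¹ := by
      rw [inv_mul_eq_one] at hab
      rw [hab, mul_inv_cancel_right]
    exact this ▸ H.mul_mem a.2 (H.inv_mem b.2)

end

end Globalization

end UnitalPartialAction

theorem theorem3p1 {k : Type w'} {G : Type u} {S : Type v} [CommRing k] [Group G] [Finite G]
    [CommRing S] [Algebra k S] (α : UnitalPartialAction k G S) (hα : α.IsPartialGalois)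
    (H : Subgroup G) [H.Normal] :
    ∃ γ : UnitalPartialAction k (G ⧸ H) (α.restrict H).invariants,
      -- the partial action `γ` is the one induced by a globalization of `α`,
      (∃ (T : Type (max u v)) (_ : CommRing T) (_ : Algebra k T)
        (E : UnitalPartialAction.Globalization α T), E.Induces H γ) ∧
      -- no matter which globalization is taken,
      (∀ (T : Type w) [CommRing T] [Algebra k T]
        (E : UnitalPartialAction.Globalization α T), E.Induces H γ) ∧
      -- and with it `S^{α_H}` is a partial Galois extension of `S^α`.
      γ.invariants.map (α.restrict H).invariants.val = α.invariants ∧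
      γ.IsPartialGalois := by
  have := Fintype.ofFinite H
  let E := α.standardGlobalization
  have hE := E.quotientPartialAction_induces (H := H)
  refine ⟨E.quotientPartialAction H, ⟨_, _, _, E, hE⟩, fun T _ _ E' => hE.congr E', ?_,
    E.quotientPartialAction_isPartialGalois hα⟩
  ext s
  constructor
  · rintro ⟨x, hx, rfl⟩
    exact E.mem_quotientPartialAction_invariants.1 hx
  · intro hs
    exact ⟨⟨s, fun g => hs g⟩, E.mem_quotientPartialAction_invariants.2 hs, rfl⟩
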